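/- **Conventions.** An $r$-uniform hypergraph $H=(V,E)$ has a finite vertex set $V$, and $E$ is a set of $r$-element subsets of $V$. A set $I\subseteq V$ is independent if it contains no edge, and $\mathrm{IND}(H)\subseteq\mathbb{R}^V$ is the convex hull of the characteristic functions of the independent sets. For $r\ge 2$ and $x\in V$, the link $H_x$ is the $(r-1)$-uniform hypergraph with vertex set $V_x=\{\,y\in V\setminus\{x\}: \text{some } e\in E \text{ contains } x \text{ and } y\,\}$ in which an $(r-1)$-subset $e$ of $V_x$ is an edge if and only if $e\cup\{x\}\in E$. The theta body $\mathrm{TH}(H)\subseteq\mathbb{R}^V$ is defined recursively: $\mathrm{TH}(H)=\mathrm{IND}(H)$ if $r=1$; if $r\ge2$, then $\mathrm{TH}(H)$ is the set of all $f\in\mathbb{R}^V$ for which there is a matrix $F\in\mathbb{R}^{V\times V}$ with diagonal $f$ such that the matrix $\begin{pmatrix}1&f^{\mathsf T}\\ f&F\end{pmatrix}$ is (symmetric and) positive semidefinite and, for every $x\in V$ whose link is nonempty, the restriction to $V_x$ of the row $(F(x,y))_{y\in V}$ belongs to $F(x,x)\,\mathrm{TH}(H_x)$. The theta number of $H$ is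 $\vartheta(H)=\max\{\sum_{x\in V}f(x): f\in\mathrm{TH}(H)\}$. For integers $n,s\ge1$ let $\mathbb{H}^n=\{0,1\}^n$ with the Hamming distance $d$, and let $\mathbb{H}^n_s$ be the set of words in $\mathbb{H}^n$ with exactly $s$ ones. Let $H(n,s)$ be the $3$-uniform hypergraph with vertex set $\mathbb{H}^n$ whose edges are the $s$-triangles, that is, the sets of three distinct points of $\mathbb{H}^n$ at pairwise Hamming distance $s$, and let $H(n,s)_0$ be the link of the vertex $0$. For $k,t\in\{0,\dots,n\}$ let $$K^n_k(t)=\binom nk^{-1}\sum_{i=0}^k(-1)^i\binom ti\binom{n-t}{k-i}$$ be the value at $t$ of the Krawtchouk polynomial of degree $k$, normalized so that $K^n_k(0)=1$, and let $M_K^n(s)=\min\{K^n_k(s): k=0,\dots,n\}$. **Theorem.** If $n\ge1$ is an integer and $s$ is an even integer with $0<s\le\lfloor 2n/3\rfloor$, then the maxima defining $\vartheta(H(n,s))$ and $\vartheta(H(n,s)_0)$ are attained, and $$\vartheta(H(n,s))=2^n\,\frac{M_K^n(s)-|\mathbb{H}^n_s|^{-1}\,\vartheta(H(n,s)_0)}{M_K^n(s)-1}.$$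 -/

import Mathlib

/-- An `r`-uniform hypergraph: every edge is an `r`-element subset of the vertex set. -/
structure UniformHypergraph (α : Type*) (r : ℕ) extends Hypergraph α where
  encard_of_mem_edgeSet : ∀ e ∈ edgeSet, e.encard = (r : ℕ∞)

namespace UniformHypergraph

variable {α : Type*}

/-- The link of `x`: its vertices are the `y ≠ x` that lie in a common edge with `x`, and a set `e`
of such vertices is an edge if and only if `e ∪ {x}` is an edge of `H`. -/
def link {r : ℕ} (H : UniformHypergraph α (r + 1)) (x : α) : UniformHypergraph α r where
  vertexSet := {y | y ≠ x ∧ ∃ e ∈ H.edgeSet, x ∈ e ∧ y ∈ e}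
  edgeSet := {e | e ⊆ {y | y ≠ x ∧ ∃ e' ∈ H.edgeSet, x ∈ e' ∧ y ∈ e'} ∧ insert x e ∈ H.edgeSet}
  subset_vertexSet_of_mem_edgeSet' := fun _ he => he.1
  encard_of_mem_edgeSet := by
    rintro e ⟨he, hxe⟩
    have hx : x ∉ e := fun h => (he h).1 rfl
    have h := H.encard_of_mem_edgeSet _ hxe
    rw [Set.encard_insert_of_notMem hx, Nat.cast_add, Nat.cast_one] at h
    exact WithTop.add_right_cancel ENat.one_ne_top h

theorem link_vertexSet_subset {r : ℕ} (H : UniformHypergraph α (r + 1)) (x : α) :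
    (H.link x).vertexSet ⊆ H.vertexSet := by
  rintro y ⟨_, e, he, _, hy⟩
  exact H.subset_vertexSet_of_mem_edgeSet' he hy

/-- A set of vertices is independent if it contains no edge. -/
def IsIndependent {r : ℕ} (H : UniformHypergraph α r) (I : Set α) : Prop :=
  I ⊆ H.vertexSet ∧ ∀ e ∈ H.edgeSet, ¬ e ⊆ I

/-- The independent-set polytope: the convex hull of the characteristic functions of the
independent sets. -/
def indPolytope {r : ℕ} (H : UniformHypergraph α r) : Set (H.vertexSet → ℝ) :=
  convexHull ℝ {f | ∃ I : Set α, H.IsIndependent I ∧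
    f = fun x : H.vertexSet => I.indicator (fun _ => (1 : ℝ)) (x : α)}

/-- The bordered matrix `[[1, aᵀ], [a, A]]`, where `a` is the diagonal of `A`. -/
def bordered {V : Type*} (A : Matrix V V ℝ) : Matrix (Unit ⊕ V) (Unit ⊕ V) ℝ :=
  Matrix.fromBlocks (1 : Matrix Unit Unit ℝ) (Matrix.replicateRow Unit A.diag)
    (Matrix.replicateCol Unit A.diag) A

/-- The theta body of an `r`-uniform hypergraph for `r ≥ 1`, by recursion on `k = r - 1`.
For `r = 1` it is the independent-set polytope. For `r ≥ 2` it consists of the diagonals of the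
matrices `F` whose bordered matrix is positive semidefinite and such that, for every vertex `x`
with nonempty link, the row of `x` restricted to the link of `x` lies in the dilation of the theta
body of the link by the factor `F x x`. -/
def thetaBody : {k : ℕ} → (H : UniformHypergraph α (k + 1)) → Set (H.vertexSet → ℝ)
  | 0, H => H.indPolytope
  | _ + 1, H => {f | ∃ F : Matrix H.vertexSet H.vertexSet ℝ,
      f = F.diag ∧
      (∀ x : H.vertexSet, (H.link x).vertexSet.Nonempty →
        ∃ g ∈ thetaBody (H.link x), ∀ y : (H.link x).vertexSet,
          F x ⟨y, H.link_vertexSet_subset x y.2⟩ = F x x * g y) ∧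
      (bordered F).PosSemidef}

open Classical in
/-- The values of the linear functional with weights `w` on the theta body. -/
def thetaValues [Fintype α] {k : ℕ} (H : UniformHypergraph α (k + 1)) (w : H.vertexSet → ℝ) :
    Set ℝ :=
  {v | ∃ f ∈ H.thetaBody, v = ∑ x : H.vertexSet, w x * f x}

/-- The theta number for the weight function `w`: the largest value of the functional with weights
`w` on the theta body. -/
noncomputable def weightedThetaNumber [Fintype α] {k : ℕ} (H : UniformHypergraph α (k + 1))
    (w : H.vertexSet → ℝ) : ℝ :=
  sSup (H.thetaValues w)

/-- The theta number, for unit weights. -/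
noncomputable def thetaNumber [Fintype α] {k : ℕ} (H : UniformHypergraph α (k + 1)) : ℝ :=
  H.weightedThetaNumber (fun _ => 1)

end UniformHypergraph

/-- The Hamming cube `{0, 1}ⁿ`. -/
abbrev HammingCube (n : ℕ) : Type := Fin n → ZMod 2

/-- The words of weight `s`. -/
def hammingSphere (n s : ℕ) : Finset (HammingCube n) :=
  Finset.univ.filter fun x => hammingNorm x = s

/-- The 3-uniform hypergraph on the Hamming cube whose edges are the `s`-triangles: the sets of
three distinct points with all pairwise Hamming distances equal to `s`. -/
def triangleHypergraph (n s : ℕ) : UniformHypergraph (HammingCube n) 3 where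
  vertexSet := Set.univ
  edgeSet := {e | e.encard = 3 ∧ e.Pairwise fun x y => hammingDist x y = s}
  subset_vertexSet_of_mem_edgeSet' := fun _ _ => Set.subset_univ _
  encard_of_mem_edgeSet := fun _ he => he.1

/-- The value at `t ∈ {0, …, n}` of the Krawtchouk polynomial of degree `k`, normalized to have
value 1 at 0. -/
noncomputable def krawtchouk (n k t : ℕ) : ℝ :=
  ((n.choose k : ℕ) : ℝ)⁻¹ *
    ∑ i ∈ Finset.range (k + 1), (-1 : ℝ) ^ i * (t.choose i : ℝ) * ((n - t).choose (k - i) : ℝ)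

/-- The minimum of the values at `s` of the normalized Krawtchouk polynomials of degrees
`0, …, n`. -/
noncomputable def krawtchoukMin (n s : ℕ) : ℝ :=
  (Finset.range (n + 1)).inf' Finset.nonempty_range_add_one fun k => krawtchouk n k s

/-! Write `S` for the size of the sphere of radius `s`, `M` for `krawtchoukMin n s`, `θ` for the
theta number of the link of `0`, and `c = (M - θ/S)/(M - 1)`; the claim is that the maximum is `2^n
c`. Upper bound: let `F` be feasible with trace `T`, and let `q u ≥ 0` be its quadratic form at the
character of `u`. By Fourier inversion `2^n` times the sum of `F x (x + w)` over all `x` and all `w`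
in the sphere is `S` times the sum of `K_|u|(s) q u`. Since `∑ q u = 2^n T`, `q 0 ≥ T²` and `K_0 =
1`, this is at least `S (M 2^n T + (1 - M) T²)` (`krawtchoukMin_bound`). The link conditions make it
at most `2^n T θ` (`sum_mul_le_of_certificates`). Cancelling `T > 0` leaves `T ≤ 2^n c`. Lower
bound: if `K_k(s) = M`, the kernel `c² + (c - c²) K_k(d(x, y))` has diagonal `c` and equals `c θ/S`
at distance `s`. It is feasible because the constant `θ/S` lies in the theta body of each link:
average an optimal certificate over coordinate permutations (`LinkCertificate.exists_const`) and
translate. -/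

open Finset UniformHypergraph

/-! ### Characters of the cube and Krawtchouk values -/

/-- The two-dimensional character table of `ZMod 2`. -/
noncomputable def signChar (a b : ZMod 2) : ℝ := if a * b = 0 then 1 else -1

theorem ZMod.two_cases (a : ZMod 2) : a = 0 ∨ a = 1 := by
  revert a; decide

theorem signChar_comm (a b : ZMod 2) : signChar a b = signChar b a := by
  simp [signChar, mul_comm]

theorem signChar_add (a b c : ZMod 2) : signChar a (b + c) = signChar a b * signChar a c := by
  have h11 : (1 : ZMod 2) + 1 = 0 := by decide
  rcases ZMod.two_cases a with rfl | rfl <;> rcases ZMod.two_cases b with rfl | rfl <;>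
    rcases ZMod.two_cases c with rfl | rfl <;> simp [signChar, h11]

/-- The character of the Hamming cube attached to the word `u`. -/
noncomputable def cubeChar {n : ℕ} (u x : HammingCube n) : ℝ := ∏ j, signChar (u j) (x j)

section
variable {n : ℕ}

theorem cubeChar_comm (u x : HammingCube n) : cubeChar u x = cubeChar x u := by
  simp [cubeChar, signChar_comm]

theorem cubeChar_add (u x y : HammingCube n) :
    cubeChar u (x + y) = cubeChar u x * cubeChar u y := by
  simp [cubeChar, signChar_add, prod_mul_distrib]

theorem cube_sub_eq_add (x y : HammingCube n) : x - y = x + y := by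
  ext j
  have : ∀ a b : ZMod 2, a - b = a + b := by decide
  exact this _ _

theorem cubeChar_sub (u x y : HammingCube n) :
    cubeChar u (x - y) = cubeChar u x * cubeChar u y := by
  rw [cube_sub_eq_add, cubeChar_add]

@[simp] theorem cubeChar_zero_left (x : HammingCube n) : cubeChar 0 x = 1 := by
  simp [cubeChar, signChar]

/-- The sum factors over coordinates, each contributing `1 + X` or `1 - X`. A polynomial variable
`X` gives the Krawtchouk values as coefficients; `X = 1` gives orthogonality. -/
theorem sum_pow_mul_cubeChar {R : Type*} [CommRing R] [Algebra ℝ R] (X : R)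
    (x : HammingCube n) :
    ∑ u : HammingCube n, X ^ hammingNorm u * algebraMap ℝ R (cubeChar u x) =
      (1 - X) ^ hammingNorm x * (1 + X) ^ (n - hammingNorm x) := by
  have h1 : ∀ u : HammingCube n, X ^ hammingNorm u * algebraMap ℝ R (cubeChar u x) =
      ∏ j, (if u j = 0 then 1 else X) * algebraMap ℝ R (signChar (u j) (x j)) := by
    intro u
    rw [prod_mul_distrib, cubeChar, map_prod, prod_ite]
    simp [hammingNorm]
  rw [sum_congr rfl fun u _ => h1 u,
    ← Fintype.prod_sum fun j (b : ZMod 2) =>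
      (if b = 0 then 1 else X) * algebraMap ℝ R (signChar b (x j))]
  have h2 : ∀ j, ∑ b : ZMod 2, (if b = 0 then 1 else X) * algebraMap ℝ R (signChar b (x j)) =
      if x j ≠ 0 then 1 - X else 1 + X := by
    intro j
    have : (univ : Finset (ZMod 2)) = {0, 1} := by decide
    rw [this, sum_pair (by decide)]
    rcases ZMod.two_cases (x j) with h | h <;> simp [h, signChar, sub_eq_add_neg]
  rw [prod_congr rfl fun j _ => h2 j, prod_ite, prod_const, prod_const]
  congr 2
  have := card_filter_add_card_filter_not (s := (univ : Finset (Fin n))) fun j => x j ≠ 0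
  rw [card_univ, Fintype.card_fin] at this
  simp only [hammingNorm]
  omega

theorem hammingNorm_le_dim (x : HammingCube n) : hammingNorm x ≤ n := by
  simpa using hammingNorm_le_card_fintype (x := x)

theorem card_hammingSphere_eq_choose (k : ℕ) : (hammingSphere n k).card = n.choose k := by
  have h := sum_pow_mul_cubeChar (Polynomial.X : Polynomial ℝ) (0 : HammingCube n)
  have h' := congrArg (fun p => Polynomial.coeff p k) h
  simp only [Polynomial.finsetSum_coeff, hammingNorm_zero, pow_zero, one_mul, Nat.sub_zero,
    Polynomial.coeff_one_add_X_pow, cubeChar_comm _ (0 : HammingCube n), cubeChar_zero_left,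
    map_one, mul_one, Polynomial.coeff_X_pow] at h'
  rw [sum_boole] at h'
  have h'' : (hammingSphere n k).card = n.choose k := by
    rw [← Nat.cast_inj (R := ℝ), ← h', hammingSphere]
    simp [eq_comm]
  exact h''

theorem sum_hammingSphere_cubeChar {k : ℕ} (hk : k ≤ n) (x : HammingCube n) :
    ∑ u ∈ hammingSphere n k, cubeChar u x = n.choose k * krawtchouk n k (hammingNorm x) := by
  have h := sum_pow_mul_cubeChar (Polynomial.X : Polynomial ℝ) x
  have h' := congrArg (fun p => Polynomial.coeff p k) h
  have hc : ∀ t i : ℕ, ((1 - Polynomial.X : Polynomial ℝ) ^ t).coeff i = (-1) ^ i * t.choose i := by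
    intro t i
    have : (1 - Polynomial.X : Polynomial ℝ) ^ t = ((1 + Polynomial.X) ^ t).comp
        (Polynomial.C (-1) * Polynomial.X) := by
      simp [sub_eq_add_neg]
    rw [this, Polynomial.comp_C_mul_X_coeff, Polynomial.coeff_one_add_X_pow, mul_comm]
  simp only [Polynomial.finsetSum_coeff, Polynomial.coeff_mul, hc, Polynomial.coeff_one_add_X_pow]
    at h'
  rw [Finset.Nat.sum_antidiagonal_eq_sum_range_succ_mk] at h'
  have hne : (n.choose k : ℝ) ≠ 0 := by exact_mod_cast (Nat.choose_pos hk).ne'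
  rw [krawtchouk, mul_inv_cancel_left₀ hne, ← h', hammingSphere, sum_filter]
  refine sum_congr rfl fun u _ => ?_
  rw [← Polynomial.coeff_mul, Polynomial.algebraMap_eq, Polynomial.coeff_mul_C,
    Polynomial.coeff_X_pow]
  simp [eq_comm]

theorem sum_cubeChar (x : HammingCube n) :
    ∑ u, cubeChar u x = if x = 0 then 2 ^ n else 0 := by
  have h := sum_pow_mul_cubeChar (1 : ℝ) x
  simp only [one_pow, one_mul, Algebra.algebraMap_self, RingHom.id_apply, sub_self] at h
  rw [h]
  split_ifs with hx
  · subst hx; norm_num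
  · rw [zero_pow (by simpa using hx), zero_mul]

/-- Reciprocity between degree and argument: the sum depends on `u` only through its weight, so it
can be averaged over that weight class and the double sum evaluated in the other order. -/
theorem sum_sphere_cubeChar_eq {s : ℕ} (hs : s ≤ n) (u : HammingCube n) :
    ∑ w ∈ hammingSphere n s, cubeChar u w =
      (hammingSphere n s).card * krawtchouk n (hammingNorm u) s := by
  have hconst : ∀ v ∈ hammingSphere n (hammingNorm u), ∑ w ∈ hammingSphere n s, cubeChar v w =
      ∑ w ∈ hammingSphere n s, cubeChar u w := by
    intro v hv
    have hv' : hammingNorm v = hammingNorm u := by simpa [hammingSphere] using hv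
    simp only [cubeChar_comm v, cubeChar_comm u]
    rw [sum_hammingSphere_cubeChar hs, sum_hammingSphere_cubeChar hs, hv']
  have h1 : ∑ w ∈ hammingSphere n s, ∑ v ∈ hammingSphere n (hammingNorm u), cubeChar v w =
      (hammingSphere n s).card *
        ((n.choose (hammingNorm u)) * krawtchouk n (hammingNorm u) s) := by
    rw [sum_congr rfl (g := fun _ => (n.choose (hammingNorm u) : ℝ) *
      krawtchouk n (hammingNorm u) s)]
    · simp
    · intro w hw
      have hw' : hammingNorm w = s := by simpa [hammingSphere] using hw
      rw [sum_hammingSphere_cubeChar (hammingNorm_le_dim u), hw']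
  rw [sum_comm, sum_congr rfl hconst, sum_const, card_hammingSphere_eq_choose, nsmul_eq_mul] at h1
  have hne : (n.choose (hammingNorm u) : ℝ) ≠ 0 := by
    exact_mod_cast (Nat.choose_pos (hammingNorm_le_dim u)).ne'
  apply mul_left_cancel₀ hne
  rw [h1]; ring

theorem exists_krawtchouk_eq_min (n s : ℕ) :
    ∃ k ≤ n, krawtchouk n k s = krawtchoukMin n s := by
  obtain ⟨k, hk, h⟩ := exists_mem_eq_inf' (nonempty_range_add_one (n := n))
    fun k => krawtchouk n k s
  exact ⟨k, by simpa [Nat.lt_succ_iff] using hk, h.symm⟩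

theorem krawtchoukMin_le {k s : ℕ} (hk : k ≤ n) : krawtchoukMin n s ≤ krawtchouk n k s :=
  inf'_le (fun k => krawtchouk n k s) (by simpa [Nat.lt_succ_iff] using hk)

theorem krawtchouk_zero_left (s : ℕ) : krawtchouk n 0 s = 1 := by
  simp [krawtchouk]

theorem krawtchouk_zero_right {k : ℕ} (hk : k ≤ n) : krawtchouk n k 0 = 1 := by
  have h := sum_hammingSphere_cubeChar hk (0 : HammingCube n)
  simp only [cubeChar_comm _ (0 : HammingCube n), cubeChar_zero_left, hammingNorm_zero, sum_const,
    card_hammingSphere_eq_choose, nsmul_eq_mul, mul_one] at h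
  have hne : (n.choose k : ℝ) ≠ 0 := by exact_mod_cast (Nat.choose_pos hk).ne'
  exact (mul_left_cancel₀ hne (by rw [← h, mul_one])).symm

theorem hammingSphere_nonempty {s : ℕ} (hs : s ≤ n) : (hammingSphere n s).Nonempty := by
  rw [← card_pos, card_hammingSphere_eq_choose]
  exact Nat.choose_pos hs

/-- Summed over all `u`, the sphere sums of characters cancel because `0` is not on the sphere; they
cannot all be positive. -/
theorem krawtchoukMin_nonpos {s : ℕ} (hs0 : 0 < s) (hs : s ≤ n) : krawtchoukMin n s ≤ 0 := by
  by_contra! hpos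
  obtain ⟨x, hx⟩ := hammingSphere_nonempty hs
  have hx' : hammingNorm x = s := by simpa [hammingSphere] using hx
  have hc : 0 < ((hammingSphere n s).card : ℝ) := by
    exact_mod_cast (hammingSphere_nonempty hs).card_pos
  have h1 : ∑ u : HammingCube n, ∑ w ∈ hammingSphere n s, cubeChar u w = 0 := by
    rw [sum_comm]
    refine sum_eq_zero fun w hw => ?_
    have hw' : hammingNorm w = s := by simpa [hammingSphere] using hw
    rw [sum_cubeChar, if_neg]
    rintro rfl
    simp at hw'; omega
  have h2 : 0 < ∑ u : HammingCube n, ∑ w ∈ hammingSphere n s, cubeChar u w := by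
    refine sum_pos (fun u _ => ?_) univ_nonempty
    rw [sum_sphere_cubeChar_eq hs]
    exact mul_pos hc (hpos.trans_le (krawtchoukMin_le (hammingNorm_le_dim u)))
  exact h2.ne' h1

end

/-! ### Positive semidefinite bordered matrices -/

theorem bordered_posSemidef_iff {V : Type*} [Fintype V] (A : Matrix V V ℝ) :
    (bordered A).PosSemidef ↔ (∀ x y, A x y = A y x) ∧
      ∀ (c : ℝ) (v : V → ℝ),
        0 ≤ c ^ 2 + 2 * c * ∑ x, A x x * v x + ∑ x, ∑ y, v x * A x y * v y := by
  have hform : ∀ w : Unit ⊕ V → ℝ, star w ⬝ᵥ (Matrix.mulVec (bordered A) w) =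
      w (Sum.inl ()) ^ 2 + 2 * w (Sum.inl ()) * ∑ x, A x x * w (Sum.inr x) +
        ∑ x, ∑ y, w (Sum.inr x) * A x y * w (Sum.inr y) := by
    intro w
    simp only [dotProduct, Matrix.mulVec, bordered, Fintype.sum_sum_type, Pi.star_apply, star_trivial,
      Matrix.fromBlocks_apply₁₁, Matrix.fromBlocks_apply₁₂, Matrix.fromBlocks_apply₂₁,
      Matrix.fromBlocks_apply₂₂, Matrix.replicateRow_apply, Matrix.replicateCol_apply,
      Matrix.diag_apply, univ_unique, sum_singleton, Matrix.one_apply_eq, PUnit.default_eq_unit,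
      mul_add, sum_add_distrib, mul_sum]
    have : ∀ x, 2 * w (Sum.inl ()) * (A x x * w (Sum.inr x)) =
        w (Sum.inl ()) * (A x x * w (Sum.inr x)) + w (Sum.inr x) * (A x x * w (Sum.inl ())) :=
      fun x => by ring
    simp only [this, sum_add_distrib, mul_assoc]
    ring
  rw [Matrix.posSemidef_iff_dotProduct_mulVec]
  refine and_congr ?_ ?_
  · constructor
    · intro h x y
      simpa [bordered] using h.apply (Sum.inr y) (Sum.inr x)
    · intro h
      refine Matrix.IsHermitian.ext fun i j => ?_
      rcases i with i | i <;> rcases j with j | j <;> simp [bordered, h]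
  · constructor
    · intro h c v
      have := h (Sum.elim (fun _ => c) v)
      rwa [hform] at this
    · intro h w
      rw [hform]
      exact h _ _

theorem bordered_submatrix {V W : Type*} (A : Matrix V V ℝ) (e : W → V) :
    bordered (A.submatrix e e) = (bordered A).submatrix (Sum.map id e) (Sum.map id e) := by
  ext i j
  rcases i with i | i <;> rcases j with j | j <;> simp [bordered]

theorem bordered_submatrix_posSemidef {V W : Type*} {A : Matrix V V ℝ}
    (hA : (bordered A).PosSemidef) (e : W → V) : (bordered (A.submatrix e e)).PosSemidef := by
  rw [bordered_submatrix]
  exact hA.submatrix _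

theorem bordered_sq_sum_le {V : Type*} [Fintype V] {A : Matrix V V ℝ}
    (hA : (bordered A).PosSemidef) (v : V → ℝ) :
    (∑ x, A x x * v x) ^ 2 ≤ ∑ x, ∑ y, v x * A x y * v y := by
  -- This border coordinate minimizes the form, as in a Schur complement.
  have := ((bordered_posSemidef_iff A).1 hA).2 (-∑ x, A x x * v x) v
  nlinarith

theorem bordered_diag_le_one {V : Type*} [Fintype V] {A : Matrix V V ℝ}
    (hA : (bordered A).PosSemidef) (x : V) : A x x ≤ 1 := by
  classical
  have := bordered_sq_sum_le hA (Pi.single x 1)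
  simp [Pi.single_apply] at this
  nlinarith

theorem bordered_diag_nonneg {V : Type*} [Fintype V] {A : Matrix V V ℝ}
    (hA : (bordered A).PosSemidef) (x : V) : 0 ≤ A x x := by
  classical
  have := bordered_sq_sum_le hA (Pi.single x 1)
  simp [Pi.single_apply] at this
  nlinarith

theorem bordered_abs_le_one {V : Type*} [Fintype V] {A : Matrix V V ℝ}
    (hA : (bordered A).PosSemidef) (x y : V) : |A x y| ≤ 1 := by
  classical
  rcases eq_or_ne x y with rfl | hxy
  · rw [abs_of_nonneg (bordered_diag_nonneg hA x)]
    exact bordered_diag_le_one hA x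
  have hsymm := ((bordered_posSemidef_iff A).1 hA).1 x y
  have hx := bordered_diag_le_one hA x
  have hy := bordered_diag_le_one hA y
  have key : ∀ ε : ℝ, 0 ≤ A x x + 2 * ε * A x y + ε ^ 2 * A y y := by
    intro ε
    have := (sq_nonneg _).trans (bordered_sq_sum_le hA (Pi.single x 1 + Pi.single y ε))
    simp [Pi.single_apply, add_mul, mul_add, sum_add_distrib] at this
    rw [← hsymm] at this
    linarith
  have h1 := key 1
  have h2 := key (-1)
  rw [abs_le]
  constructor <;> linarith

theorem isClosed_bordered_posSemidef {V : Type*} [Fintype V] :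
    IsClosed {A : Matrix V V ℝ | (bordered A).PosSemidef} := by
  simp only [bordered_posSemidef_iff, Set.ofPred_and, Set.ofPred_forall]
  refine IsClosed.inter ?_ ?_
  · exact isClosed_iInter fun x => isClosed_iInter fun y =>
      isClosed_eq (by fun_prop) (by fun_prop)
  · exact isClosed_iInter fun c => isClosed_iInter fun v =>
      isClosed_le (by fun_prop) (by fun_prop)

/-! ### Links and theta bodies in terms of matrices on the whole cube -/

section
variable {n s : ℕ}

theorem mem_hammingSphere {x : HammingCube n} : x ∈ hammingSphere n s ↔ hammingNorm x = s := by
  simp [hammingSphere]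

theorem hammingDist_eq_norm_sub (x y : HammingCube n) : hammingDist x y = hammingNorm (y - x) := by
  rw [hammingDist_eq_hammingNorm, neg_add_eq_sub]

/-- With `s = 2t`, take half of the support of `d` and `t` coordinates outside it; these exist
because `3t ≤ n`. Thus every pair at distance `s` lies in a triangle, and links are full spheres. -/
theorem exists_norm_eq_dist_eq (hs_even : Even s) (hs_le : s ≤ 2 * n / 3) {d : HammingCube n}
    (hd : hammingNorm d = s) : ∃ w : HammingCube n, hammingNorm w = s ∧ hammingNorm (w - d) = s := by
  obtain ⟨t, rfl⟩ := hs_even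
  set D : Finset (Fin n) := univ.filter fun j => d j ≠ 0 with hD
  have hDc : D.card = t + t := hd
  obtain ⟨D', hD', hD'c⟩ := exists_subset_card_eq (s := D) (n := t) (by omega)
  have hcompl : Dᶜ.card = n - (t + t) := by rw [card_compl, hDc, Fintype.card_fin]
  obtain ⟨C, hC, hCc⟩ := exists_subset_card_eq (s := Dᶜ) (n := t) (by omega)
  have hCD : Disjoint C D := by
    rw [← le_compl_iff_disjoint_right]; exact hC
  refine ⟨fun j => if j ∈ D' ∪ C then 1 else 0, ?_, ?_⟩
  · have : (univ.filter fun j => (if j ∈ D' ∪ C then (1 : ZMod 2) else 0) ≠ 0) = D' ∪ C := by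
      ext j; by_cases h : j ∈ D' <;> simp [h]
    rw [hammingNorm, this, card_union_of_disjoint (hCD.symm.mono_left hD'), hD'c, hCc]
  · have : (univ.filter fun j => ((fun j => if j ∈ D' ∪ C then (1 : ZMod 2) else 0) - d) j ≠ 0) =
        (D \ D') ∪ C := by
      ext j
      have h1 : j ∈ D ↔ d j ≠ 0 := by simp [hD]
      have h2 : j ∈ D' → j ∈ D := fun h => hD' h
      have h3 : j ∈ C → j ∉ D := fun h => by simpa using hC h
      rcases ZMod.two_cases (d j) with h | h <;> by_cases h4 : j ∈ D' <;> by_cases h5 : j ∈ C <;>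
        simp_all
    rw [hammingNorm, this, card_union_of_disjoint (hCD.symm.mono_left sdiff_subset),
      card_sdiff_of_subset hD', hD'c, hCc, hDc]
    omega

theorem triple_mem_edgeSet (hs_pos : 0 < s) {x y z : HammingCube n} (hxy : hammingDist x y = s)
    (hxz : hammingDist x z = s) (hyz : hammingDist y z = s) :
    ({x, y, z} : Set (HammingCube n)) ∈ (triangleHypergraph n s).edgeSet := by
  have ne : ∀ {a b : HammingCube n}, hammingDist a b = s → a ≠ b := by
    rintro a b h rfl
    simp at h; omega
  refine ⟨Set.encard_eq_three.2 ⟨x, y, z, ne hxy, ne hxz, ne hyz, rfl⟩, ?_⟩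
  rintro a (rfl | rfl | rfl) b (rfl | rfl | rfl) hab <;>
    first
      | exact absurd rfl hab
      | assumption
      | (rw [hammingDist_comm]; assumption)

theorem link_vertexSet_eq (hs_even : Even s) (hs_pos : 0 < s) (hs_le : s ≤ 2 * n / 3)
    (x : HammingCube n) :
    ((triangleHypergraph n s).link x).vertexSet = {y | hammingDist x y = s} := by
  ext y
  constructor
  · rintro ⟨hne, e, ⟨_, he⟩, hx, hy⟩
    exact he hx hy hne.symm
  · intro hy
    have hne : y ≠ x := by
      rintro rfl
      simp at hy; omega
    obtain ⟨w, hw, hwd⟩ := exists_norm_eq_dist_eq (d := y - x) hs_even hs_le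
      (by rw [← hammingDist_eq_norm_sub]; exact hy)
    refine ⟨hne, {x, y, x + w}, triple_mem_edgeSet hs_pos hy ?_ ?_, by simp, by simp⟩
    · rw [hammingDist_eq_norm_sub, add_sub_cancel_left, hw]
    · rw [hammingDist_eq_norm_sub, ← hwd]
      congr 1; abel

theorem link_link_edge_iff (hs_pos : 0 < s) {x y z : HammingCube n}
    (hxy : hammingDist x y = s) :
    z ∈ (((triangleHypergraph n s).link x).link y).vertexSet ↔
      hammingDist x z = s ∧ hammingDist y z = s := by
  constructor
  · rintro ⟨hne, e, ⟨hsub, he3, he⟩, hy, hz⟩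
    exact ⟨he (Set.mem_insert _ _) (Set.mem_insert_of_mem _ hz) (hsub hz).1.symm,
      he (Set.mem_insert_of_mem _ hy) (Set.mem_insert_of_mem _ hz) hne.symm⟩
  · rintro ⟨hxz, hyz⟩
    have ne : ∀ {a b : HammingCube n}, hammingDist a b = s → b ≠ a := by
      rintro a b h rfl
      simp at h; omega
    have hE := triple_mem_edgeSet hs_pos hxy hxz hyz
    refine ⟨ne hyz, {y, z}, ⟨?_, hE⟩, by simp, by simp⟩
    rintro a (rfl | rfl)
    · exact ⟨ne hxy, _, hE, by simp, by simp⟩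
    · exact ⟨ne hxz, _, hE, by simp, by simp⟩

/-- Only the empty set is independent here. Applied to a link of a link, this turns the recursive
condition into vanishing of the entries at adjacent pairs. -/
theorem indPolytope_eq_zero {α : Type*} (H : UniformHypergraph α 1)
    (hH : ∀ z ∈ H.vertexSet, {z} ∈ H.edgeSet) : H.indPolytope = {0} := by
  have : {f | ∃ I : Set α, H.IsIndependent I ∧
      f = fun x : H.vertexSet => I.indicator (fun _ => (1 : ℝ)) (x : α)} = {0} := by
    ext f
    constructor
    · rintro ⟨I, ⟨hI, hIe⟩, rfl⟩
      ext x
      refine Set.indicator_of_notMem (fun hx => hIe _ (hH _ x.2) ?_) _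
      simpa using hx
    · rintro rfl
      refine ⟨∅, ⟨Set.empty_subset _, fun e he h => ?_⟩, by ext; simp⟩
      have h1 := H.encard_of_mem_edgeSet e he
      rw [Set.subset_empty_iff.1 h] at h1
      simp at h1
  rw [indPolytope, this, convexHull_singleton]

theorem singleton_mem_link_edgeSet {α : Type*} (H : UniformHypergraph α 2) (y z : α)
    (hz : z ∈ (H.link y).vertexSet) : {z} ∈ (H.link y).edgeSet := by
  obtain ⟨hne, e, he, hy, hze⟩ := hz
  have hsub : ({y, z} : Set α) ⊆ e := by
    rintro a (rfl | rfl) <;> assumption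
  have heq : ({y, z} : Set α) = e := (Set.toFinite _).eq_of_subset_of_encard_le hsub (by
    rw [H.encard_of_mem_edgeSet e he, Set.encard_pair hne.symm]; rfl)
  exact ⟨by rintro a rfl; exact ⟨hne, e, he, hy, hze⟩, by rw [heq]; exact he⟩

/-- A matrix certifying membership in the theta body of the link of `x`, extended to the whole
cube. -/
def LinkCertificate (s : ℕ) (x : HammingCube n)
    (G : Matrix (HammingCube n) (HammingCube n) ℝ) : Prop :=
  (bordered G).PosSemidef ∧ ∀ y z, hammingDist x y = s → hammingDist x z = s →
    hammingDist y z = s → G y z = 0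

theorem mem_thetaBody_link_iff (hs_even : Even s) (hs_pos : 0 < s) (hs_le : s ≤ 2 * n / 3)
    (x : HammingCube n) (g : ((triangleHypergraph n s).link x).vertexSet → ℝ) :
    g ∈ ((triangleHypergraph n s).link x).thetaBody ↔
      ∃ G, LinkCertificate s x G ∧ ∀ y, g y = G y y := by
  have hV := link_vertexSet_eq hs_even hs_pos hs_le x
  have hdist : ∀ y : ((triangleHypergraph n s).link x).vertexSet, hammingDist x y = s :=
    fun y => hV.le y.2
  have hzero : ∀ y, (((triangleHypergraph n s).link x).link y).thetaBody = {0} := fun y =>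
    indPolytope_eq_zero _ fun z hz => singleton_mem_link_edgeSet _ y z hz
  constructor
  · rintro ⟨F, rfl, hF, hpsd⟩
    classical
    obtain ⟨w, hw⟩ := hammingSphere_nonempty (n := n) (s := s) (by omega)
    have hw' : x + w ∈ ((triangleHypergraph n s).link x).vertexSet := by
      rw [hV]
      simpa [hammingDist_eq_norm_sub] using mem_hammingSphere.1 hw
    -- Points off the sphere go to an arbitrary sphere point: repeating rows and columns preserves
    -- semidefiniteness, and the vanishing condition concerns sphere points only.
    let e : HammingCube n → ((triangleHypergraph n s).link x).vertexSet := fun y =>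
      if hy : y ∈ ((triangleHypergraph n s).link x).vertexSet then ⟨y, hy⟩ else ⟨_, hw'⟩
    have he : ∀ y (hy : y ∈ ((triangleHypergraph n s).link x).vertexSet), e y = ⟨y, hy⟩ :=
      fun y hy => dif_pos hy
    refine ⟨F.submatrix e e, ⟨bordered_submatrix_posSemidef hpsd e, ?_⟩, ?_⟩
    · intro y z hxy hxz hyz
      have hy : y ∈ ((triangleHypergraph n s).link x).vertexSet := by rw [hV]; exact hxy
      have hz : z ∈ ((triangleHypergraph n s).link x).vertexSet := by rw [hV]; exact hxz
      have hz' : z ∈ (((triangleHypergraph n s).link x).link y).vertexSet :=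
        (link_link_edge_iff hs_pos hxy).2 ⟨hxz, hyz⟩
      obtain ⟨g, hg, hgF⟩ := hF ⟨y, hy⟩ ⟨z, hz'⟩
      have hg0 : g = 0 := by
        have := hzero y
        rw [this] at hg
        exact hg
      have := hgF ⟨z, hz'⟩
      rw [hg0] at this
      rw [Matrix.submatrix_apply, he y hy, he z hz]
      simpa using this
    · intro y
      rw [Matrix.submatrix_apply, he y y.2]
      rfl
  · rintro ⟨G, ⟨hpsd, hG⟩, hg⟩
    refine ⟨G.submatrix Subtype.val Subtype.val, ?_, ?_,
      bordered_submatrix_posSemidef hpsd _⟩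
    · ext y; exact hg y
    · intro y _
      refine ⟨0, by rw [hzero]; rfl, fun z => ?_⟩
      have := (link_link_edge_iff hs_pos (hdist y)).1 z.2
      simpa using hG y z (hdist y) this.1 this.2

theorem mem_thetaBody_triangle_iff (hs_even : Even s) (hs_pos : 0 < s) (hs_le : s ≤ 2 * n / 3)
    (f : (triangleHypergraph n s).vertexSet → ℝ) :
    f ∈ (triangleHypergraph n s).thetaBody ↔
      ∃ F : Matrix (HammingCube n) (HammingCube n) ℝ, (∀ y, f y = F y y) ∧
        (bordered F).PosSemidef ∧ ∀ x, ∃ G, LinkCertificate s x G ∧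
          ∀ y, hammingDist x y = s → F x y = F x x * G y y := by
  have hV := link_vertexSet_eq hs_even hs_pos hs_le
  constructor
  · rintro ⟨F, rfl, hF, hpsd⟩
    let e : HammingCube n → (triangleHypergraph n s).vertexSet := fun y => ⟨y, Set.mem_univ y⟩
    refine ⟨F.submatrix e e, fun y => rfl, bordered_submatrix_posSemidef hpsd e, fun x => ?_⟩
    -- The row condition is available only for nonempty links, so a link vertex must be exhibited.
    obtain ⟨w, hw⟩ := hammingSphere_nonempty (n := n) (s := s) (by omega)
    obtain ⟨g, hg, hgF⟩ := hF (e x) ⟨x + w, by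
      rw [hV]; simpa [e, hammingDist_eq_norm_sub] using mem_hammingSphere.1 hw⟩
    obtain ⟨G, hG, hgG⟩ := (mem_thetaBody_link_iff hs_even hs_pos hs_le _ g).1 hg
    refine ⟨G, hG, fun y hy => ?_⟩
    have := hgF ⟨y, by rw [hV]; exact hy⟩
    rw [hgG] at this
    exact this
  · rintro ⟨F, hf, hpsd, hF⟩
    refine ⟨F.submatrix Subtype.val Subtype.val, ?_, ?_, bordered_submatrix_posSemidef hpsd _⟩
    · ext y; exact hf y
    · intro x _
      obtain ⟨G, hG, hFG⟩ := hF x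
      refine ⟨fun y => G y y, (mem_thetaBody_link_iff hs_even hs_pos hs_le _ _).2
        ⟨G, hG, fun _ => rfl⟩, fun y => hFG y ((hV x).le y.2)⟩

theorem thetaValues_triangle (hs_even : Even s) (hs_pos : 0 < s) (hs_le : s ≤ 2 * n / 3) (v : ℝ) :
    v ∈ (triangleHypergraph n s).thetaValues (fun _ => 1) ↔
      ∃ F : Matrix (HammingCube n) (HammingCube n) ℝ, v = ∑ x, F x x ∧
        (bordered F).PosSemidef ∧ ∀ x, ∃ G, LinkCertificate s x G ∧
          ∀ y, hammingDist x y = s → F x y = F x x * G y y := by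
  classical
  have hsum : ∀ F : Matrix (HammingCube n) (HammingCube n) ℝ,
      ∑ x : (triangleHypergraph n s).vertexSet, F x x = ∑ x, F x x := fun F =>
    (sum_subtype univ (fun x => ⟨fun _ => Set.mem_univ x, fun _ => Finset.mem_univ x⟩)
      fun y => F y y).symm
  constructor
  · rintro ⟨f, hf, rfl⟩
    obtain ⟨F, hfF, hF⟩ := (mem_thetaBody_triangle_iff hs_even hs_pos hs_le f).1 hf
    refine ⟨F, ?_, hF⟩
    simp only [one_mul, hfF]
    rw [← hsum]
  · rintro ⟨F, rfl, hF⟩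
    refine ⟨fun y => F y y, (mem_thetaBody_triangle_iff hs_even hs_pos hs_le _).2
      ⟨F, fun _ => rfl, hF⟩, ?_⟩
    simp only [one_mul]
    rw [← hsum]

theorem thetaValues_link (hs_even : Even s) (hs_pos : 0 < s) (hs_le : s ≤ 2 * n / 3) :
    ((triangleHypergraph n s).link 0).thetaValues (fun _ => 1) =
      (fun G : Matrix (HammingCube n) (HammingCube n) ℝ => ∑ y ∈ hammingSphere n s, G y y) ''
        {G | LinkCertificate s 0 G} := by
  have hV := link_vertexSet_eq hs_even hs_pos hs_le (0 : HammingCube n)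
  classical
  have hsum : ∀ G : Matrix (HammingCube n) (HammingCube n) ℝ,
      ∑ x : ((triangleHypergraph n s).link 0).vertexSet, G x x =
        ∑ y ∈ hammingSphere n s, G y y := fun G => by
    refine (sum_subtype (hammingSphere n s) (fun x => ?_) fun y => G y y).symm
    rw [hV, mem_hammingSphere, Set.mem_ofPred_eq, hammingDist_zero_left]
  ext v
  constructor
  · rintro ⟨g, hg, rfl⟩
    obtain ⟨G, hG, hgG⟩ := (mem_thetaBody_link_iff hs_even hs_pos hs_le 0 g).1 hg
    refine ⟨G, hG, ?_⟩
    simp only [one_mul, hgG]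
    rw [← hsum]
  · rintro ⟨G, hG, rfl⟩
    refine ⟨fun y => G y y, (mem_thetaBody_link_iff hs_even hs_pos hs_le 0 _).2
      ⟨G, hG, fun _ => rfl⟩, ?_⟩
    simp only [one_mul]
    rw [← hsum]

/-- The constraints are closed and force all entries into `[-1, 1]`; this gives attainment of the
maximum for the link. -/
theorem isCompact_linkCertificate (x : HammingCube n) :
    IsCompact {G | LinkCertificate s x G} := by
  refine IsCompact.of_isClosed_subset (isCompact_univ_pi fun y : HammingCube n =>
    isCompact_univ_pi fun z : HammingCube n => isCompact_Icc (a := (-1 : ℝ)) (b := 1)) ?_ ?_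
  · simp only [LinkCertificate, Set.ofPred_and, Set.ofPred_forall]
    refine isClosed_bordered_posSemidef.inter ?_
    exact isClosed_iInter fun y => isClosed_iInter fun z => isClosed_iInter fun _ =>
      isClosed_iInter fun _ => isClosed_iInter fun _ => isClosed_eq (by fun_prop) (by fun_prop)
  · rintro G ⟨hG, _⟩ y _ z _
    exact abs_le.1 (bordered_abs_le_one hG y z)

theorem linkCertificate_zero (x : HammingCube n) : LinkCertificate s x 0 := by
  refine ⟨(bordered_posSemidef_iff _).2 ⟨fun _ _ => rfl, fun c v => ?_⟩, fun _ _ _ _ _ => rfl⟩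
  simpa using sq_nonneg c

theorem isGreatest_thetaNumber_link (hs_even : Even s) (hs_pos : 0 < s)
    (hs_le : s ≤ 2 * n / 3) :
    IsGreatest (((triangleHypergraph n s).link 0).thetaValues fun _ => 1)
      ((triangleHypergraph n s).link 0).thetaNumber := by
  have hK : IsCompact (((triangleHypergraph n s).link 0).thetaValues fun _ => 1) := by
    rw [thetaValues_link hs_even hs_pos hs_le]
    refine (isCompact_linkCertificate 0).image ?_
    fun_prop
  refine hK.isGreatest_sSup ?_
  rw [thetaValues_link hs_even hs_pos hs_le]
  exact ⟨_, 0, linkCertificate_zero 0, rfl⟩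

end

/-! ### Symmetry: translations and coordinate permutations -/

section
variable {n s : ℕ}

theorem hammingDist_add_left (a x y : HammingCube n) :
    hammingDist (a + x) (a + y) = hammingDist x y := by
  rw [hammingDist_eq_norm_sub, hammingDist_eq_norm_sub]
  congr 1; abel

theorem LinkCertificate.translate {x : HammingCube n}
    {G : Matrix (HammingCube n) (HammingCube n) ℝ} (hG : LinkCertificate s x G)
    (a : HammingCube n) :
    LinkCertificate s (x - a) (G.submatrix (a + ·) (a + ·)) := by
  refine ⟨bordered_submatrix_posSemidef hG.1 _, fun y z hy hz hyz => ?_⟩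
  refine hG.2 _ _ ?_ ?_ ?_
  · rw [← hy, ← hammingDist_add_left a (x - a), add_sub_cancel]
  · rw [← hz, ← hammingDist_add_left a (x - a), add_sub_cancel]
  · rw [hammingDist_add_left, hyz]

/-- The action of a coordinate permutation on the Hamming cube. -/
def permuteWord (σ : Equiv.Perm (Fin n)) (x : HammingCube n) : HammingCube n := fun j => x (σ j)

theorem hammingDist_permuteWord (σ : Equiv.Perm (Fin n)) (x y : HammingCube n) :
    hammingDist (permuteWord σ x) (permuteWord σ y) = hammingDist x y := by
  simp only [hammingDist, permuteWord]
  refine card_bij (fun j _ => σ j) ?_ ?_ ?_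
  · exact fun a ha => mem_filter.2 ⟨mem_univ _, (mem_filter.1 ha).2⟩
  · intro a _ b _ h; exact σ.injective h
  · intro b hb
    exact ⟨σ.symm b, mem_filter.2 ⟨mem_univ _, by simpa using hb⟩, by simp⟩

theorem permuteWord_zero (σ : Equiv.Perm (Fin n)) : permuteWord σ (0 : HammingCube n) = 0 := rfl

theorem hammingNorm_permuteWord (σ : Equiv.Perm (Fin n)) (x : HammingCube n) :
    hammingNorm (permuteWord σ x) = hammingNorm x := by
  have h := hammingDist_permuteWord σ 0 x
  rwa [permuteWord_zero, hammingDist_zero_left] at h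

/-- A bijection between the supports extends to a permutation. It runs from the support of `y` to
that of `x` because `permuteWord` precomposes. -/
theorem exists_permuteWord_eq {x y : HammingCube n} (h : hammingNorm x = hammingNorm y) :
    ∃ σ, permuteWord σ x = y := by
  classical
  have e : Nonempty ({j // y j ≠ 0} ≃ {j // x j ≠ 0}) := by
    rw [← Fintype.card_eq, Fintype.card_subtype, Fintype.card_subtype]
    exact h.symm
  obtain ⟨e⟩ := e
  refine ⟨e.extendSubtype, ?_⟩
  ext j
  by_cases hj : y j ≠ 0
  · have h1 : x (e.extendSubtype j) ≠ 0 := e.extendSubtype_mem j hj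
    have h2 := (ZMod.two_cases _).resolve_left h1
    rw [permuteWord, h2, (ZMod.two_cases _).resolve_left hj]
  · have h1 : ¬ x (e.extendSubtype j) ≠ 0 := e.extendSubtype_not_mem j hj
    push Not at h1 hj
    rw [permuteWord, h1, hj]

/-- The average of a matrix over the coordinate permutations. -/
noncomputable def permAverage (G : Matrix (HammingCube n) (HammingCube n) ℝ) :
    Matrix (HammingCube n) (HammingCube n) ℝ := fun y z =>
  (Fintype.card (Equiv.Perm (Fin n)) : ℝ)⁻¹ *
    ∑ σ : Equiv.Perm (Fin n), G (permuteWord σ y) (permuteWord σ z)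

/-- Certificates at `0` form a convex set, invariant under coordinate permutations since these fix
`0` and preserve distances. -/
theorem LinkCertificate.permAverage {G : Matrix (HammingCube n) (HammingCube n) ℝ}
    (hG : LinkCertificate s 0 G) : LinkCertificate s 0 (permAverage G) := by
  have hsub : ∀ σ : Equiv.Perm (Fin n), (bordered (G.submatrix (permuteWord σ) (permuteWord σ))).PosSemidef :=
    fun σ => bordered_submatrix_posSemidef hG.1 _
  simp only [bordered_posSemidef_iff, Matrix.submatrix_apply] at hsub
  refine ⟨(bordered_posSemidef_iff _).2 ⟨fun x y => ?_, fun c v => ?_⟩, fun y z hy hz hyz => ?_⟩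
  · simp only [_root_.permAverage, fun σ => (hsub σ).1 x y]
  · have h := mul_nonneg (inv_nonneg.2 (Nat.cast_nonneg (α := ℝ) (Fintype.card (Equiv.Perm (Fin n)))))
      (sum_nonneg fun σ (_ : σ ∈ (univ : Finset (Equiv.Perm (Fin n)))) => (hsub σ).2 c v)
    have hN : (Fintype.card (Equiv.Perm (Fin n)) : ℝ) ≠ 0 := by
      exact_mod_cast Fintype.card_ne_zero
    refine h.trans_eq ?_
    have h1 : ∑ x, _root_.permAverage G x x * v x =
        (Fintype.card (Equiv.Perm (Fin n)) : ℝ)⁻¹ *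
          ∑ σ : Equiv.Perm (Fin n), ∑ x, G (permuteWord σ x) (permuteWord σ x) * v x := by
      rw [sum_comm, mul_sum]
      simp only [_root_.permAverage, sum_mul, mul_assoc]
    have h2 : ∑ x, ∑ y, v x * _root_.permAverage G x y * v y =
        (Fintype.card (Equiv.Perm (Fin n)) : ℝ)⁻¹ *
          ∑ σ : Equiv.Perm (Fin n), ∑ x, ∑ y, v x * G (permuteWord σ x) (permuteWord σ y) * v y := by
      conv_rhs => rw [sum_comm, mul_sum]
      refine sum_congr rfl fun x _ => ?_
      conv_rhs => rw [sum_comm, mul_sum]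
      refine sum_congr rfl fun y _ => ?_
      simp only [_root_.permAverage, ← sum_mul, ← mul_sum]
      ring
    rw [h1, h2, sum_add_distrib, sum_add_distrib, ← mul_sum, mul_add, mul_add, sum_const,
      card_univ, nsmul_eq_mul, inv_mul_cancel_left₀ hN]
    ring
  · simp only [_root_.permAverage]
    rw [sum_eq_zero, mul_zero]
    intro σ _
    refine hG.2 _ _ ?_ ?_ ?_
    · rw [← permuteWord_zero σ, hammingDist_permuteWord, hy]
    · rw [← permuteWord_zero σ, hammingDist_permuteWord, hz]
    · rw [hammingDist_permuteWord, hyz]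

theorem permAverage_permuteWord (G : Matrix (HammingCube n) (HammingCube n) ℝ)
    (τ : Equiv.Perm (Fin n)) (x : HammingCube n) :
    permAverage G (permuteWord τ x) (permuteWord τ x) = permAverage G x x := by
  simp only [permAverage]
  congr 1
  exact Fintype.sum_equiv (Equiv.mulLeft τ) _ _ fun σ => rfl

theorem sum_permAverage_diag (G : Matrix (HammingCube n) (HammingCube n) ℝ) :
    ∑ y ∈ hammingSphere n s, permAverage G y y = ∑ y ∈ hammingSphere n s, G y y := by
  have hN : (Fintype.card (Equiv.Perm (Fin n)) : ℝ) ≠ 0 := by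
    exact_mod_cast Fintype.card_ne_zero
  simp only [permAverage]
  rw [← mul_sum, sum_comm, sum_congr rfl (g := fun _ => ∑ y ∈ hammingSphere n s, G y y)]
  · rw [sum_const, card_univ, nsmul_eq_mul, inv_mul_cancel_left₀ hN]
  · intro σ _
    refine sum_bij' (fun y _ => permuteWord σ y) (fun y _ => permuteWord σ.symm y) ?_ ?_ ?_ ?_ ?_
    · intro y hy
      simpa [mem_hammingSphere, hammingNorm_permuteWord] using hy
    · intro y hy
      simpa [mem_hammingSphere, hammingNorm_permuteWord] using hy
    · intro y _; ext j; simp [permuteWord]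
    · intro y _; ext j; simp [permuteWord]
    · intro y _; rfl

/-- A link certificate may be replaced by one whose diagonal is constant on the sphere. -/
theorem LinkCertificate.exists_const {G : Matrix (HammingCube n) (HammingCube n) ℝ}
    (hG : LinkCertificate s 0 G) (hs : s ≤ n) :
    ∃ G', LinkCertificate s 0 G' ∧ ∀ y ∈ hammingSphere n s, G' y y =
      ((hammingSphere n s).card : ℝ)⁻¹ * ∑ z ∈ hammingSphere n s, G z z := by
  refine ⟨_, hG.permAverage, fun y hy => ?_⟩
  have hc : ((hammingSphere n s).card : ℝ) ≠ 0 := by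
    exact_mod_cast (hammingSphere_nonempty hs).card_pos.ne'
  rw [← sum_permAverage_diag, sum_congr rfl (g := fun _ => _root_.permAverage G y y)]
  · rw [sum_const, nsmul_eq_mul, inv_mul_cancel_left₀ hc]
  · intro z hz
    obtain ⟨σ, rfl⟩ := exists_permuteWord_eq
      ((mem_hammingSphere.1 hy).trans (mem_hammingSphere.1 hz).symm)
    exact permAverage_permuteWord G σ y

/-- Translating `x` to `0` lets one constant bound all links. -/
theorem LinkCertificate.sum_le (hs_even : Even s) (hs_pos : 0 < s) (hs_le : s ≤ 2 * n / 3)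
    {x : HammingCube n} {G : Matrix (HammingCube n) (HammingCube n) ℝ}
    (hG : LinkCertificate s x G) :
    ∑ w ∈ hammingSphere n s, G (x + w) (x + w) ≤
      ((triangleHypergraph n s).link 0).thetaNumber := by
  refine (isGreatest_thetaNumber_link hs_even hs_pos hs_le).2 ?_
  rw [thetaValues_link hs_even hs_pos hs_le]
  have h := hG.translate x
  rw [sub_self] at h
  exact ⟨_, h, rfl⟩

/-! ### The upper bound by Fourier analysis -/

/-- Fourier inversion on the Hamming cube, for quadratic forms. -/
theorem sum_charForm_mul (F : Matrix (HammingCube n) (HammingCube n) ℝ) (w : HammingCube n) :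
    ∑ u, cubeChar u w * ∑ x, ∑ y, cubeChar u x * F x y * cubeChar u y =
      2 ^ n * ∑ x, F x (x + w) := by
  have h1 : ∀ x y, ∑ u, cubeChar u w * (cubeChar u x * F x y * cubeChar u y) =
      if y = x + w then 2 ^ n * F x y else 0 := by
    intro x y
    have h2 : ∀ u, cubeChar u w * (cubeChar u x * F x y * cubeChar u y) =
        F x y * cubeChar u (y - (x + w)) := by
      intro u
      rw [cubeChar_sub, cubeChar_add]; ring
    rw [sum_congr rfl fun u _ => h2 u, ← mul_sum]
    have h3 := sum_cubeChar (y - (x + w))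
    rw [h3]
    simp only [sub_eq_zero]
    split_ifs <;> ring
  simp only [mul_sum]
  rw [sum_comm]
  refine sum_congr rfl fun x _ => ?_
  rw [sum_comm, sum_congr rfl fun y _ => h1 x y]
  simp

theorem sum_mul_le_of_certificates (hs_even : Even s) (hs_pos : 0 < s) (hs_le : s ≤ 2 * n / 3)
    {F : Matrix (HammingCube n) (HammingCube n) ℝ} (hF : (bordered F).PosSemidef)
    (hlink : ∀ x, ∃ G, LinkCertificate s x G ∧
      ∀ y, hammingDist x y = s → F x y = F x x * G y y) :
    ∑ w ∈ hammingSphere n s, ∑ x, F x (x + w) ≤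
      (∑ x, F x x) * ((triangleHypergraph n s).link 0).thetaNumber := by
  rw [sum_comm, sum_mul]
  refine sum_le_sum fun x _ => ?_
  obtain ⟨G, hG, hFG⟩ := hlink x
  have h : ∀ w ∈ hammingSphere n s, F x (x + w) = F x x * G (x + w) (x + w) := by
    intro w hw
    refine hFG _ ?_
    rw [hammingDist_eq_norm_sub, add_sub_cancel_left, mem_hammingSphere.1 hw]
  rw [sum_congr rfl h, ← mul_sum]
  exact mul_le_mul_of_nonneg_left (hG.sum_le hs_even hs_pos hs_le) (bordered_diag_nonneg hF x)

theorem krawtchoukMin_bound (hs : s ≤ n) {F : Matrix (HammingCube n) (HammingCube n) ℝ}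
    (hF : (bordered F).PosSemidef) :
    ((hammingSphere n s).card : ℝ) * (krawtchoukMin n s * (2 ^ n * ∑ x, F x x) +
        (1 - krawtchoukMin n s) * (∑ x, F x x) ^ 2) ≤
      2 ^ n * ∑ w ∈ hammingSphere n s, ∑ x, F x (x + w) := by
  set M := krawtchoukMin n s
  set S := ((hammingSphere n s).card : ℝ)
  let q : HammingCube n → ℝ := fun u => ∑ x, ∑ y, cubeChar u x * F x y * cubeChar u y
  have hq : ∀ u, 0 ≤ q u := fun u =>
    (sq_nonneg _).trans (bordered_sq_sum_le hF (cubeChar u))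
  have hq0 : (∑ x, F x x) ^ 2 ≤ q 0 := by
    simpa [q] using bordered_sq_sum_le hF (cubeChar 0)
  have hsum : ∑ u, q u = 2 ^ n * ∑ x, F x x := by
    have h0 : ∀ u : HammingCube n, cubeChar u 0 = 1 := fun u => by
      rw [cubeChar_comm, cubeChar_zero_left]
    simpa [h0] using sum_charForm_mul F 0
  have hM1 : M ≤ 1 := by
    have := krawtchoukMin_le (n := n) (s := s) (Nat.zero_le n)
    rwa [krawtchouk_zero_left] at this
  have hS : 0 ≤ S := Nat.cast_nonneg _
  have hrhs : 2 ^ n * ∑ w ∈ hammingSphere n s, ∑ x, F x (x + w) =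
      S * ∑ u, krawtchouk n (hammingNorm u) s * q u := by
    rw [mul_sum, sum_congr rfl fun w _ => (sum_charForm_mul F w).symm, sum_comm, mul_sum]
    refine sum_congr rfl fun u _ => ?_
    rw [← sum_mul, sum_sphere_cubeChar_eq hs, mul_assoc]
  rw [hrhs, ← hsum]
  refine mul_le_mul_of_nonneg_left ?_ hS
  -- Every coefficient is at least `M`, but at `u = 0` it is exactly `1`; this surplus yields the
  -- term quadratic in the trace.
  have hsplit : M * ∑ u, q u + (1 - M) * q 0 ≤ ∑ u, krawtchouk n (hammingNorm u) s * q u := by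
    have h1 : M * ∑ u, q u + (1 - M) * q 0 = ∑ u, (M * q u + if u = 0 then (1 - M) * q u else 0) := by
      rw [sum_add_distrib, mul_sum]; simp
    rw [h1]
    refine sum_le_sum fun u _ => ?_
    split_ifs with hu
    · subst hu
      rw [hammingNorm_zero, krawtchouk_zero_left]
      linarith
    · rw [add_zero]
      exact mul_le_mul_of_nonneg_right (krawtchoukMin_le (hammingNorm_le_dim u)) (hq u)
  have := mul_le_mul_of_nonneg_left hq0 (sub_nonneg.2 hM1)
  linarith

/-! ### The extremal kernel and the formula -/

/-- The positive semidefinite kernel `c² J + (c - c²) K_k(d(x, y))`. -/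
theorem bordered_krawtchouk_posSemidef {k : ℕ} (hk : k ≤ n) {c : ℝ} (hc0 : 0 ≤ c) (hc1 : c ≤ 1) :
    (bordered fun x y : HammingCube n =>
      c ^ 2 + (c - c ^ 2) * krawtchouk n k (hammingDist x y)).PosSemidef := by
  have hne : (n.choose k : ℝ) ≠ 0 := by exact_mod_cast (Nat.choose_pos hk).ne'
  refine (bordered_posSemidef_iff _).2 ⟨fun x y => by rw [hammingDist_comm], fun b v => ?_⟩
  have hker : ∀ x y : HammingCube n, krawtchouk n k (hammingDist x y) =
      (n.choose k : ℝ)⁻¹ * ∑ u ∈ hammingSphere n k, cubeChar u x * cubeChar u y := by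
    intro x y
    rw [hammingDist_comm, hammingDist_eq_norm_sub, ← sum_congr rfl fun u _ => cubeChar_sub u x y,
      sum_hammingSphere_cubeChar hk, inv_mul_cancel_left₀ hne]
  have hquad : ∑ x, ∑ y, v x * (c ^ 2 + (c - c ^ 2) * krawtchouk n k (hammingDist x y)) * v y =
      c ^ 2 * (∑ x, v x) ^ 2 + (c - c ^ 2) * ((n.choose k : ℝ)⁻¹ *
        ∑ u ∈ hammingSphere n k, (∑ x, cubeChar u x * v x) ^ 2) := by
    have h1 : ∑ u ∈ hammingSphere n k, (∑ x, cubeChar u x * v x) ^ 2 =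
        ∑ x, ∑ y, v x * (∑ u ∈ hammingSphere n k, cubeChar u x * cubeChar u y) * v y := by
      simp only [sq, mul_sum, sum_mul]
      rw [sum_comm]
      refine sum_congr rfl fun x _ => ?_
      rw [sum_comm]
      exact sum_congr rfl fun y _ => sum_congr rfl fun u _ => by ring
    have h2 : (∑ x, v x) ^ 2 = ∑ x, ∑ y, v x * v y := by rw [sq, sum_mul_sum]
    rw [h1, h2]
    simp only [hker, mul_sum (s := univ), ← sum_add_distrib]
    exact sum_congr rfl fun x _ => sum_congr rfl fun y _ => by ring
  rw [hquad]
  simp only [hammingDist_self, krawtchouk_zero_right hk, mul_one, add_sub_cancel, ← mul_sum]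
  have h3 : 0 ≤ (c - c ^ 2) * ((n.choose k : ℝ)⁻¹ *
        ∑ u ∈ hammingSphere n k, (∑ x, cubeChar u x * v x) ^ 2) := by
    refine mul_nonneg (by nlinarith) (mul_nonneg (by positivity) (sum_nonneg fun _ _ => sq_nonneg _))
  -- The whole form is `(b + c ∑ v)²` plus the nonnegative term `h3`.
  nlinarith [sq_nonneg (b + c * ∑ x, v x)]

theorem krawtchoukMin_formula_isGreatest (hs_even : Even s) (hs_pos : 0 < s)
    (hs_le : s ≤ 2 * n / 3) :
    IsGreatest ((triangleHypergraph n s).thetaValues fun _ => 1)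
      (2 ^ n * ((krawtchoukMin n s -
        ((hammingSphere n s).card : ℝ)⁻¹ * ((triangleHypergraph n s).link 0).thetaNumber) /
          (krawtchoukMin n s - 1))) := by
  have hsn : s ≤ n := by omega
  have hS : 0 < ((hammingSphere n s).card : ℝ) := by
    exact_mod_cast (hammingSphere_nonempty hsn).card_pos
  have hM0 := krawtchoukMin_nonpos hs_pos hsn
  obtain ⟨k, hk, hkM⟩ := exists_krawtchouk_eq_min n s
  obtain ⟨hmem, hmax⟩ := isGreatest_thetaNumber_link hs_even hs_pos hs_le
  rw [thetaValues_link hs_even hs_pos hs_le] at hmem hmax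
  obtain ⟨G, hG, hGθ⟩ := hmem
  simp only at hGθ
  have hθ0 : 0 ≤ ((triangleHypergraph n s).link 0).thetaNumber := by
    rw [← hGθ]; exact sum_nonneg fun y _ => bordered_diag_nonneg hG.1 y
  have hθS : ((triangleHypergraph n s).link 0).thetaNumber ≤ (hammingSphere n s).card := by
    rw [← hGθ]
    refine (sum_le_sum fun y _ => bordered_diag_le_one hG.1 y).trans_eq ?_
    simp
  have hub := fun {F} => sum_mul_le_of_certificates (F := F) hs_even hs_pos hs_le
  have hlb := fun {F} => krawtchoukMin_bound (F := F) hsn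
  obtain ⟨G', hG', hG'c⟩ := hG.exists_const hsn
  rw [hGθ] at hG'c
  generalize ((triangleHypergraph n s).link 0).thetaNumber = θ at *
  generalize krawtchoukMin n s = M at *
  generalize ((hammingSphere n s).card : ℝ) = S at *
  set c := (M - S⁻¹ * θ) / (M - 1) with hcdef
  have hr0 : 0 ≤ S⁻¹ * θ := by positivity
  have hr1 : S⁻¹ * θ ≤ 1 := by
    rw [inv_mul_le_iff₀ hS, mul_one]; exact hθS
  have hcM : c * (1 - M) = S⁻¹ * θ - M := by
    have : M - 1 ≠ 0 := by linarith
    -- The identity says `c + (1 - c) M = θ/S`, the ratio of the kernel at distance `s` to its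
    -- diagonal. With `M ≤ 0` and `0 ≤ θ/S ≤ 1` it also forces `0 ≤ c ≤ 1`.
    rw [hcdef]; field_simp; ring
  have hc0 : 0 ≤ c := by
    by_contra! h; nlinarith
  have hc1 : c ≤ 1 := by
    by_contra! h; nlinarith
  constructor
  · rw [thetaValues_triangle hs_even hs_pos hs_le]
    refine ⟨fun x y => c ^ 2 + (c - c ^ 2) * krawtchouk n k (hammingDist x y), ?_,
      bordered_krawtchouk_posSemidef hk hc0 hc1, fun x => ?_⟩
    · simp [krawtchouk_zero_right hk]
    · have h := hG'.translate (-x)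
      rw [zero_sub, neg_neg] at h
      refine ⟨_, h, fun y hy => ?_⟩
      have hy' : -x + y ∈ hammingSphere n s := by
        rw [mem_hammingSphere, ← hy, hammingDist_eq_norm_sub, neg_add_eq_sub]
      beta_reduce
      rw [Matrix.submatrix_apply, hG'c _ hy', hy, hkM, hammingDist_self, krawtchouk_zero_right hk]
      linear_combination c * hcM
  · intro v hv
    obtain ⟨F, rfl, hF, hlink⟩ := (thetaValues_triangle hs_even hs_pos hs_le v).1 hv
    have h1 := hub hF hlink
    have h2 := hlb hF
    have hT : 0 ≤ ∑ x, F x x := sum_nonneg fun x _ => bordered_diag_nonneg hF x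
    set T := ∑ x, F x x
    have hN : (0 : ℝ) < 2 ^ n := by positivity
    by_contra! hlt
    -- Since `c ≥ 0`, exceeding the bound makes `T` positive, so the two estimates contradict each
    -- other strictly.
    have hT0 : 0 < T := lt_of_le_of_lt (by positivity) hlt
    have h3 : S * (M * (2 ^ n * T) + (1 - M) * T ^ 2) ≤ 2 ^ n * (T * θ) :=
      h2.trans (mul_le_mul_of_nonneg_left h1 hN.le)
    have h4 : θ = S * (c * (1 - M) + M) := by
      rw [hcM]; field_simp; ring
    have h5 : 0 < S * (T * ((1 - M) * (T - 2 ^ n * c))) :=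
      mul_pos hS (mul_pos hT0 (mul_pos (by linarith) (sub_pos.2 hlt)))
    rw [h4] at h3
    linarith

end

theorem theorem6p1 (n s : ℕ) (hn : 1 ≤ n) (hs_even : Even s) (hs_pos : 0 < s)
    (hs_le : s ≤ 2 * n / 3) :
    IsGreatest ((triangleHypergraph n s).thetaValues fun _ => 1)
        (triangleHypergraph n s).thetaNumber ∧
      IsGreatest (((triangleHypergraph n s).link 0).thetaValues fun _ => 1)
        ((triangleHypergraph n s).link 0).thetaNumber ∧
      (triangleHypergraph n s).thetaNumber =
        2 ^ n *
          ((krawtchoukMin n s -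
              ((hammingSphere n s).card : ℝ)⁻¹ * ((triangleHypergraph n s).link 0).thetaNumber) /
            (krawtchoukMin n s - 1)) := by
  have h := krawtchoukMin_formula_isGreatest hs_even hs_pos hs_le
  have heq : (triangleHypergraph n s).thetaNumber = _ := h.csSup_eq
  exact ⟨by rw [heq]; exact h, isGreatest_thetaNumber_link hs_even hs_pos hs_le, heq⟩
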